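/- For $\mu_0\in\mathcal P_{2,ac}(\mathbb R^d)$ (absolutely continuous probability measures with finite second moment) and $\nu\in\mathcal P_2(\mathbb R^d)$ (probability measures with finite second moment) let $T_{\mu_0}^{\nu}$ denote the optimal transport map, i.e. the ($\mu_0$-a.e. unique) minimizer of $\int\|T(x)-x\|^2\,d\mu_0(x)$ over Borel maps $T$ with $T\#\mu_0=\nu$. Let $W_2$ be the $2$-Wasserstein distance (defined through couplings, with values in $[0,\infty]$ on $\mathcal P(\mathbb R^d)$), and $\Delta^m=\{\lambda\in\mathbb R^m:\lambda_i\ge 0,\ \sum_i\lambda_i=1\}$. **Proposition.** Let $\mu_0,\mu_1,\dots,\mu_m\in\mathcal P_{2,ac}(\mathbb R^d)$ be compatible, that is, $T_{\mu_i}^{\mu_j}=T_{\mu_k}^{\mu_j}\circ T_{\mu_i}^{\mu_k}$ $\mu_i$-almost everywhere for all $i,j,k\in\{0,\dots,m\}$. Then for every $\lambda\in\Delta^m$ each of the two problems $$\operatorname*{argmin}_{\nu\in\mathcal P(\mathbb R^d)}\sum_{i=1}^m\lambda_i\|T_{\mu_0}^{\nu}-T_{\mu_0}^{\mu_i}\|_{L^2(\mu_0)}^2,\qquad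 \operatorname*{argmin}_{\nu\in\mathcal P(\mathbb R^d)}\sum_{i=1}^m\lambda_i W_2^2(\nu,\mu_i)$$ has exactly one solution (the first objective being $+\infty$ for $\nu\notin\mathcal P_2(\mathbb R^d)$), and the two solutions are the same measure $\nu_\lambda$. In particular $$\mathrm{LBCM}(\mu_0;\{\mu_i\}_{i=1}^m)=W_2\mathrm{BCM}(\{\mu_i\}_{i=1}^m),$$ where the left-hand (right-hand) side is the set of all solutions of the first (second) problem as $\lambda$ ranges over $\Delta^m$. -/

import Mathlib

open MeasureTheory
open scoped ENNReal

noncomputable section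

namespace OTBary

/-- The space `ℝ^d` with its Euclidean norm. -/
abbrev Rd (d : ℕ) : Type := EuclideanSpace ℝ (Fin d)

variable {d m : ℕ}

/-- `μ ∈ 𝒫₂(ℝ^d)`: the probability measure `μ` has a finite second moment. -/
def HasSecondMoment (μ : ProbabilityMeasure (Rd d)) : Prop :=
  MemLp (fun x : Rd d => x) 2 (μ : Measure (Rd d))

/-- `μ ∈ 𝒫_{2,ac}(ℝ^d)`: finite second moment and a density with respect to Lebesgue measure. -/
def IsP2ac (μ : ProbabilityMeasure (Rd d)) : Prop :=
  HasSecondMoment μ ∧ (μ : Measure (Rd d)) ≪ volume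

/-- `T` is a Borel map with `T # μ = ν`. -/
def IsTransportMap (μ ν : ProbabilityMeasure (Rd d)) (T : Rd d → Rd d) : Prop :=
  Measurable T ∧ (μ : Measure (Rd d)).map T = (ν : Measure (Rd d))

/-- The quadratic cost `∫ ‖T x - x‖² dμ(x)` of a map, as an extended nonnegative real. -/
def mapCost (μ : ProbabilityMeasure (Rd d)) (T : Rd d → Rd d) : ℝ≥0∞ :=
  ∫⁻ x, ‖T x - x‖ₑ ^ 2 ∂(μ : Measure (Rd d))

/-- `T` is an optimal transport map from `μ` to `ν`: it minimises the quadratic cost among all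
maps that push `μ` forward to `ν`. -/
def IsOptimalMap (μ ν : ProbabilityMeasure (Rd d)) (T : Rd d → Rd d) : Prop :=
  IsTransportMap μ ν T ∧ ∀ S, IsTransportMap μ ν S → mapCost μ T ≤ mapCost μ S

open Classical in
/-- The optimal transport map `T_μ^ν`. For `μ ∈ 𝒫_{2,ac}` and `ν ∈ 𝒫₂` an optimal map exists and
is unique up to `μ`-null sets (Brenier); the definition picks a representative. Where no optimal
map exists the value is the identity, as a placeholder. -/
def otMap (μ ν : ProbabilityMeasure (Rd d)) : Rd d → Rd d :=
  if h : ∃ T, IsOptimalMap μ ν T then h.choose else id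

/-- A finite family of measures is compatible: `T_{ν i}^{ν j} = T_{ν k}^{ν j} ∘ T_{ν i}^{ν k}`
for all `i, j, k`. Maps out of `ν i` are identified when they agree `ν i`-almost everywhere. -/
def Compatible {ι : Type*} (ν : ι → ProbabilityMeasure (Rd d)) : Prop :=
  ∀ i j k, otMap (ν i) (ν j)
    =ᵐ[(ν i : Measure (Rd d))] otMap (ν k) (ν j) ∘ otMap (ν i) (ν k)

open Classical in
/-- The squared linear optimal transport discrepancy `‖T_{μ₀}^μ - T_{μ₀}^ν‖²_{L²(μ₀)}`.
The maps are defined for `μ, ν ∈ 𝒫₂`; otherwise the value is `∞`. -/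
def lotSq (μ₀ μ ν : ProbabilityMeasure (Rd d)) : ℝ≥0∞ :=
  if HasSecondMoment μ ∧ HasSecondMoment ν then
    ∫⁻ x, ‖otMap μ₀ μ x - otMap μ₀ ν x‖ₑ ^ 2 ∂(μ₀ : Measure (Rd d))
  else ∞

/-- `π` is a coupling of `μ` and `ν`. -/
def IsCoupling (μ ν : ProbabilityMeasure (Rd d)) (π : ProbabilityMeasure (Rd d × Rd d)) : Prop :=
  (π : Measure (Rd d × Rd d)).map Prod.fst = (μ : Measure (Rd d)) ∧
    (π : Measure (Rd d × Rd d)).map Prod.snd = (ν : Measure (Rd d))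

/-- The squared `2`-Wasserstein distance between arbitrary probability measures, by optimisation
over couplings; it may be `∞`. -/
def w2Sq (μ ν : ProbabilityMeasure (Rd d)) : ℝ≥0∞ :=
  ⨅ (π : ProbabilityMeasure (Rd d × Rd d)) (_ : IsCoupling μ ν π),
    ∫⁻ z, ‖z.1 - z.2‖ₑ ^ 2 ∂(π : Measure (Rd d × Rd d))

/-- The set of solutions of
`argmin_{ν ∈ 𝒫(ℝ^d)} ∑ i, w i * ‖T_{μ₀}^ν - T_{μ₀}^{μ i}‖²_{L²(μ₀)}`. -/
def lotBarycenters (μ₀ : ProbabilityMeasure (Rd d)) (μ : Fin m → ProbabilityMeasure (Rd d))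
    (w : Fin m → ℝ) : Set (ProbabilityMeasure (Rd d)) :=
  {ν | IsMinOn (fun η => ∑ i, ENNReal.ofReal (w i) * lotSq μ₀ η (μ i)) Set.univ ν}

/-- The set of solutions of `argmin_{ν ∈ 𝒫(ℝ^d)} ∑ i, w i * W₂²(ν, μ i)`. -/
def w2Barycenters (μ : Fin m → ProbabilityMeasure (Rd d))
    (w : Fin m → ℝ) : Set (ProbabilityMeasure (Rd d)) :=
  {ν | IsMinOn (fun η => ∑ i, ENNReal.ofReal (w i) * w2Sq η (μ i)) Set.univ ν}

/-- The linear barycentric coding model: all solutions, for weights in the simplex. -/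
def LBCM (μ₀ : ProbabilityMeasure (Rd d)) (μ : Fin m → ProbabilityMeasure (Rd d)) :
    Set (ProbabilityMeasure (Rd d)) :=
  ⋃ w ∈ stdSimplex ℝ (Fin m), lotBarycenters μ₀ μ w

/-- The `2`-Wasserstein barycentric coding model. -/
def W2BCM (μ : Fin m → ProbabilityMeasure (Rd d)) : Set (ProbabilityMeasure (Rd d)) :=
  ⋃ w ∈ stdSimplex ℝ (Fin m), w2Barycenters μ w

end OTBary

end

noncomputable section

namespace OTBary

open ProbabilityTheory Topology
open scoped NNReal BoundedContinuousFunction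

variable {d m : ℕ}

/-! Put `T i = otMap μ₀ (μ i)`. The common solution is the image `ν` of `μ₀` under the average `∑ i,
w i • T i`. Both problems reduce to the identity `∑ wᵢ‖y - xᵢ‖² = ‖y - ∑ wᵢ xᵢ‖² + ∑ wᵢ wⱼ/2 ‖xᵢ -
xⱼ‖²`, integrated in `sum_ofReal_mul_lintegral_enorm_sub_sq`. By compatibility, the `L²(μ₀)`
distance of `T i` and `T j` is the Wasserstein distance of `μ i` and `μ j`, so the pair term becomes
the finite constant `pairCost`.

Linear problem: the objective at `η` is `pairCost` plus the squared distance from `otMap μ₀ η` to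
the average map. The latter is itself optimal (`averageMap_ae_eq_otMap`), so the minimum is attained
exactly at `ν`.

Wasserstein problem: gluing optimal couplings of `η` with all `μ i` gives the lower bound
`pairCost`, which `ν` attains. Equality makes `Y` the weighted mean of the `X i` and couples the `X
i` of positive weight optimally. They are then functions of a single one of them, and compatibility
identifies the law of `Y` as `ν`.

The needed form of Brenier's theorem follows from monotonicity: the support of an optimal plan is a
monotone closed set, hence a graph over almost every point. -/

/-! ### Couplings and existence of optimal plans. -/

/-- The quadratic transport cost of a plan. -/
def planCost (π : Measure (Rd d × Rd d)) : ℝ≥0∞ := ∫⁻ z, ‖z.1 - z.2‖ₑ ^ 2 ∂π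

/-- `π` is a coupling of minimal quadratic cost. -/
def IsOptimalCoupling (μ ν : ProbabilityMeasure (Rd d)) (π : ProbabilityMeasure (Rd d × Rd d)) :
    Prop :=
  IsCoupling μ ν π ∧ planCost (π : Measure (Rd d × Rd d)) = w2Sq μ ν

theorem w2Sq_le_planCost {μ ν : ProbabilityMeasure (Rd d)} {π : ProbabilityMeasure (Rd d × Rd d)}
    (h : IsCoupling μ ν π) : w2Sq μ ν ≤ planCost (π : Measure (Rd d × Rd d)) :=
  iInf₂_le π h

/-- Couplings given by a pair of random variables. -/
theorem w2Sq_le_lintegral {Ω : Type*} [MeasurableSpace Ω] (P : Measure Ω) [IsProbabilityMeasure P]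
    {μ ν : ProbabilityMeasure (Rd d)} {X Y : Ω → Rd d} (hX : Measurable X) (hY : Measurable Y)
    (hXμ : P.map X = μ) (hYν : P.map Y = ν) :
    w2Sq μ ν ≤ ∫⁻ ω, ‖X ω - Y ω‖ₑ ^ 2 ∂P := by
  have hXY : Measurable fun ω => (X ω, Y ω) := hX.prodMk hY
  let π : ProbabilityMeasure (Rd d × Rd d) :=
    ⟨P.map fun ω => (X ω, Y ω), Measure.isProbabilityMeasure_map hXY.aemeasurable⟩
  have hπ : IsCoupling μ ν π := by
    constructor
    · change (P.map _).map _ = _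
      rw [Measure.map_map measurable_fst hXY, ← hXμ]; rfl
    · change (P.map _).map _ = _
      rw [Measure.map_map measurable_snd hXY, ← hYν]; rfl
  refine (w2Sq_le_planCost hπ).trans_eq ?_
  change ∫⁻ z, _ ∂(P.map _) = _
  rw [lintegral_map (by fun_prop) hXY]

theorem isCoupling_iff_map_eq {μ ν : ProbabilityMeasure (Rd d)}
    {π : ProbabilityMeasure (Rd d × Rd d)} :
    IsCoupling μ ν π ↔ π.map (f := Prod.fst) measurable_fst.aemeasurable = μ ∧
      π.map (f := Prod.snd) measurable_snd.aemeasurable = ν := by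
  exact and_congr (ProbabilityMeasure.toMeasure_injective.eq_iff (a := π.map _) (b := μ))
    (ProbabilityMeasure.toMeasure_injective.eq_iff (a := π.map _) (b := ν))

/-- Prokhorov: fixing the two marginals is a closed condition, and tightness of the marginals gives
tightness of the plans. -/
theorem isCompact_setOf_isCoupling (μ ν : ProbabilityMeasure (Rd d)) :
    IsCompact {π | IsCoupling μ ν π} := by
  have hcl : IsClosed {π | IsCoupling μ ν π} := by
    simp only [isCoupling_iff_map_eq, Set.ofPred_and]
    exact (isClosed_singleton.preimage (ProbabilityMeasure.continuous_map continuous_fst)).inter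
      (isClosed_singleton.preimage (ProbabilityMeasure.continuous_map continuous_snd))
  rw [← hcl.closure_eq]
  refine isCompact_closure_of_isTightMeasureSet (IsTightMeasureSet.prodMk ?_ ?_)
  · refine (isTightMeasureSet_singleton (μ := (μ : Measure (Rd d)))).subset ?_
    rintro _ ⟨_, ⟨π, hπ, rfl⟩, rfl⟩
    exact hπ.1
  · refine (isTightMeasureSet_singleton (μ := (ν : Measure (Rd d)))).subset ?_
    rintro _ ⟨_, ⟨π, hπ, rfl⟩, rfl⟩
    exact hπ.2

/-- The truncations `min f n` are bounded and continuous, so the integral is a supremum of weakly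
continuous functionals. -/
theorem lowerSemicontinuous_lintegral_of_continuous {E : Type*} [TopologicalSpace E]
    [MeasurableSpace E] [OpensMeasurableSpace E] {f : E → ℝ≥0} (hf : Continuous f) :
    LowerSemicontinuous fun π : ProbabilityMeasure E => ∫⁻ z, f z ∂(π : Measure E) := by
  have key (π : ProbabilityMeasure E) : ∫⁻ z, f z ∂(π : Measure E)
      = ⨆ n : ℕ, ∫⁻ z, (min (f z) n : ℝ≥0) ∂(π : Measure E) := by
    rw [← lintegral_iSup]
    · refine lintegral_congr fun z => le_antisymm ?_ (iSup_le fun n => by simp)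
      obtain ⟨n, hn⟩ := exists_nat_ge (f z)
      exact le_iSup_of_le n (by simp [min_eq_left hn])
    · intro n
      exact (hf.min continuous_const).measurable.coe_nnreal_ennreal
    · intro a b hab z
      simp only [ENNReal.coe_le_coe]
      exact min_le_min le_rfl (by exact_mod_cast hab)
  simp only [key]
  refine lowerSemicontinuous_iSup fun n => Continuous.lowerSemicontinuous ?_
  let g : E →ᵇ ℝ≥0 := BoundedContinuousFunction.mkOfBound
    ⟨fun z => min (f z) n, hf.min continuous_const⟩ n (by
      intro x y
      rw [NNReal.dist_eq, abs_le]
      have h1 : ((min (f x) n : ℝ≥0) : ℝ) ≤ n := by exact_mod_cast min_le_right (f x) (n : ℝ≥0)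
      have h2 : ((min (f y) n : ℝ≥0) : ℝ) ≤ n := by exact_mod_cast min_le_right (f y) (n : ℝ≥0)
      have h3 := (min (f x) (n : ℝ≥0)).2
      have h4 := (min (f y) (n : ℝ≥0)).2
      simp only [NNReal.val_eq_coe] at h3 h4
      constructor <;> simp only [ContinuousMap.coe_mk] <;> linarith)
  exact ProbabilityMeasure.continuous_lintegral_boundedContinuousFunction g

theorem exists_isOptimalCoupling (μ ν : ProbabilityMeasure (Rd d)) :
    ∃ π, IsOptimalCoupling μ ν π := by
  have hne : {π | IsCoupling μ ν π}.Nonempty :=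
    ⟨⟨(μ : Measure (Rd d)).prod ν, inferInstance⟩, by
      constructor
      · change ((μ : Measure (Rd d)).prod (ν : Measure (Rd d))).map _ = _
        simp
      · change ((μ : Measure (Rd d)).prod (ν : Measure (Rd d))).map _ = _
        simp⟩
  have hf : Continuous fun z : Rd d × Rd d => ‖z.1 - z.2‖₊ ^ 2 := by fun_prop
  have hlsc := lowerSemicontinuous_lintegral_of_continuous hf
  obtain ⟨π, hπ, hmin⟩ := LowerSemicontinuousOn.exists_isMinOn hne
    (isCompact_setOf_isCoupling μ ν) (hlsc.lowerSemicontinuousOn _)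
  have hcost (π : ProbabilityMeasure (Rd d × Rd d)) :
      ∫⁻ z, ((‖z.1 - z.2‖₊ ^ 2 : ℝ≥0) : ℝ≥0∞) ∂(π : Measure (Rd d × Rd d))
        = planCost (π : Measure (Rd d × Rd d)) := by
    simp [planCost, enorm_eq_nnnorm]
  simp only [hcost] at hmin
  exact ⟨π, hπ, le_antisymm (le_iInf₂ fun π' h' => hmin h') (w2Sq_le_planCost hπ)⟩

/-! ### Gluing, and finiteness of the cost. -/

/-- Couplings with a common first marginal can be glued along that marginal. -/
theorem exists_glue {ι : Type*} [Fintype ι] (ν : ProbabilityMeasure (Rd d))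
    (π : ι → ProbabilityMeasure (Rd d × Rd d))
    (hπ : ∀ i, (π i : Measure (Rd d × Rd d)).map Prod.fst = (ν : Measure (Rd d))) :
    ∃ Q : Measure (Rd d × (ι → Rd d)), IsProbabilityMeasure Q ∧
      ∀ i, Q.map (fun p => (p.1, p.2 i)) = (π i : Measure (Rd d × Rd d)) := by
  let κ (i : ι) : Kernel (Rd d) (Rd d) := (π i : Measure (Rd d × Rd d)).condKernel
  have hκ : Measurable fun y => Measure.pi fun i => κ i y := by
    refine Measurable.measure_of_isPiSystem_of_isProbabilityMeasure generateFrom_pi.symm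
      isPiSystem_pi ?_
    rintro _ ⟨s, hs, rfl⟩
    simp only [Measure.pi_pi]
    exact Finset.measurable_fun_prod _ fun i _ => (κ i).measurable_coe (hs i (Set.mem_univ i))
  -- Given the shared coordinate, the other coordinates are drawn independently from their
  -- conditional laws.
  let K : Kernel (Rd d) (ι → Rd d) := ⟨fun y => Measure.pi fun i => κ i y, hκ⟩
  have hK (y : Rd d) : K y = Measure.pi fun i => κ i y := rfl
  have : IsMarkovKernel K := ⟨fun y => by rw [hK]; infer_instance⟩
  refine ⟨(ν : Measure (Rd d)) ⊗ₘ K, inferInstance, fun i => ?_⟩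
  have hm : Measurable fun p : Rd d × (ι → Rd d) => (p.1, p.2 i) := by fun_prop
  have hdis : (ν : Measure (Rd d)) ⊗ₘ κ i = (π i : Measure (Rd d × Rd d)) := by
    rw [← hπ i]
    exact Measure.disintegrate _ _
  ext s hs
  rw [Measure.map_apply hm hs, Measure.compProd_apply (hm hs), ← hdis, Measure.compProd_apply hs]
  refine lintegral_congr fun y => ?_
  rw [hK, ← (measurePreserving_eval (fun i => κ i y) i).measure_preimage
    (measurable_prodMk_left hs).nullMeasurableSet]
  rfl

theorem enorm_sq_eq_ofReal {E : Type*} [NormedAddCommGroup E] (x : E) :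
    ‖x‖ₑ ^ 2 = ENNReal.ofReal (‖x‖ ^ 2) := by
  rw [← ofReal_norm, ENNReal.ofReal_pow (norm_nonneg x)]

theorem lintegral_enorm_sq_eq {α E : Type*} [MeasurableSpace α] [NormedAddCommGroup E]
    (P : Measure α) (f : α → E) : ∫⁻ x, ‖f x‖ₑ ^ 2 ∂P = eLpNorm f 2 P ^ 2 := by
  have := eLpNorm_nnreal_pow_eq_lintegral (f := f) (μ := P) (p := 2) two_ne_zero
  simpa using this.symm

theorem lintegral_enorm_sq_ne_top {α E : Type*} [MeasurableSpace α] [NormedAddCommGroup E]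
    {P : Measure α} {f : α → E} (hf : MemLp f 2 P) : ∫⁻ x, ‖f x‖ₑ ^ 2 ∂P ≠ ∞ := by
  rw [lintegral_enorm_sq_eq]
  exact ENNReal.pow_ne_top hf.eLpNorm_ne_top

theorem w2Sq_ne_top {μ ν : ProbabilityMeasure (Rd d)} (hμ : HasSecondMoment μ)
    (hν : HasSecondMoment ν) : w2Sq μ ν ≠ ∞ := by
  refine ne_top_of_le_ne_top ?_ (w2Sq_le_lintegral ((μ : Measure (Rd d)).prod ν) measurable_fst
    measurable_snd (by simp) (by simp))
  have h1 : MemLp (fun z : Rd d × Rd d => z.1) 2 ((μ : Measure (Rd d)).prod ν) :=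
    hμ.comp_fst _
  have h2 : MemLp (fun z : Rd d × Rd d => z.2) 2 ((μ : Measure (Rd d)).prod ν) :=
    hν.comp_snd _
  exact lintegral_enorm_sq_ne_top (h1.sub h2)

/-! ### Cyclical monotonicity for pairs of points. -/

/-- After expanding the squares, left side minus right side is `2⟪x - x', y - y'⟫`. -/
theorem cross_cost_lt {E : Type*} [NormedAddCommGroup E] [InnerProductSpace ℝ E] {x x' y y' : E}
    (h : inner ℝ (x - x') (y - y') < 0) :
    ‖x - y'‖ₑ ^ 2 + ‖x' - y‖ₑ ^ 2 < ‖x - y‖ₑ ^ 2 + ‖x' - y'‖ₑ ^ 2 := by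
  simp only [enorm_sq_eq_ofReal]
  rw [← ENNReal.ofReal_add (by positivity) (by positivity),
    ← ENNReal.ofReal_add (by positivity) (by positivity)]
  simp only [inner_sub_left, inner_sub_right] at h
  have key : ‖x - y'‖ ^ 2 + ‖x' - y‖ ^ 2 < ‖x - y‖ ^ 2 + ‖x' - y'‖ ^ 2 := by
    simp only [norm_sub_sq_real]
    linarith
  exact (ENNReal.ofReal_lt_ofReal_iff (lt_of_le_of_lt (by positivity) key)).2 key

/-- An optimal coupling of finite cost charges no decreasing pair of points: otherwise exchanging
the second coordinates of such pairs would lower the cost. -/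
theorem IsOptimalCoupling.measure_prod_inner_neg {μ ν : ProbabilityMeasure (Rd d)}
    {π : ProbabilityMeasure (Rd d × Rd d)} (h : IsOptimalCoupling μ ν π) (hfin : w2Sq μ ν ≠ ∞) :
    ((π : Measure (Rd d × Rd d)).prod (π : Measure (Rd d × Rd d)))
      {p | inner ℝ (p.1.1 - p.2.1) (p.1.2 - p.2.2) < 0} = 0 := by
  set B : Set ((Rd d × Rd d) × (Rd d × Rd d)) :=
    {p | inner ℝ (p.1.1 - p.2.1) (p.1.2 - p.2.2) < 0} with hBdef
  have hB : MeasurableSet B :=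
    (isOpen_lt (f := fun p : (Rd d × Rd d) × (Rd d × Rd d) =>
      inner ℝ (p.1.1 - p.2.1) (p.1.2 - p.2.2)) (by fun_prop) continuous_const).measurableSet
  set P := (π : Measure (Rd d × Rd d)).prod (π : Measure (Rd d × Rd d)) with hP
  have hswap : MeasurePreserving Prod.swap P P := Measure.measurePreserving_swap
  have hBswap : Prod.swap ⁻¹' B = B := by
    ext p
    simp only [hBdef, Set.mem_preimage, Set.mem_ofPred_eq, Prod.fst_swap, Prod.snd_swap]
    rw [← neg_sub p.1.1, ← neg_sub p.1.2, inner_neg_neg]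
  have hlint (f : (Rd d × Rd d) × (Rd d × Rd d) → ℝ≥0∞) (hf : Measurable f) :
      ∫⁻ p in B, f p.swap ∂P = ∫⁻ p in B, f p ∂P := by
    have := hswap.setLIntegral_comp_preimage hB hf
    rwa [hBswap] at this
  classical
  -- `p` is a pair of independent samples of `π`. Exchanging second coordinates on `B` preserves the
  -- law `ν`, because `B` and `P` are invariant under swapping the samples.
  let Y : (Rd d × Rd d) × (Rd d × Rd d) → Rd d := fun p => if p ∈ B then p.2.2 else p.1.2
  have hY : Measurable Y := Measurable.ite hB (by fun_prop) (by fun_prop)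
  have hXlaw : P.map (fun p => p.1.1) = (μ : Measure (Rd d)) := by
    rw [← h.1.1]
    have := Measure.map_map (μ := P) (measurable_fst (α := Rd d) (β := Rd d)) measurable_fst
    refine Eq.trans this.symm ?_
    simp [hP]
  have hY0law : P.map (fun p => p.1.2) = (ν : Measure (Rd d)) := by
    rw [← h.1.2]
    have := Measure.map_map (μ := P) (measurable_snd (α := Rd d) (β := Rd d)) measurable_fst
    refine Eq.trans this.symm ?_
    simp [hP]
  have hYlaw : P.map Y = (ν : Measure (Rd d)) := by
    rw [← hY0law]
    ext A hA
    rw [Measure.map_apply hY hA, Measure.map_apply (by fun_prop) hA,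
      ← measure_inter_add_sdiff _ hB, ← measure_inter_add_sdiff ((fun p => p.1.2) ⁻¹' A) hB]
    congr 1
    · have hm : MeasurableSet ((fun p : (Rd d × Rd d) × (Rd d × Rd d) => p.1.2) ⁻¹' A ∩ B) :=
        (measurableSet_preimage (by fun_prop) hA).inter hB
      rw [← hswap.measure_preimage hm.nullMeasurableSet, Set.preimage_inter, hBswap]
      congr 1
      ext p
      simp only [Set.mem_inter_iff, Set.mem_preimage, Y, Prod.fst_swap]
      exact and_congr_left fun hp => by rw [if_pos hp]
    · congr 1
      ext p
      simp only [Set.mem_sdiff, Set.mem_preimage, Y]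
      exact and_congr_left fun hp => by rw [if_neg hp]
  let c : (Rd d × Rd d) × (Rd d × Rd d) → ℝ≥0∞ := fun p => ‖p.1.1 - p.1.2‖ₑ ^ 2
  let c' : (Rd d × Rd d) × (Rd d × Rd d) → ℝ≥0∞ := fun p => ‖p.1.1 - p.2.2‖ₑ ^ 2
  have hc : Measurable c := by fun_prop
  have hc' : Measurable c' := by fun_prop
  have hcP : ∫⁻ p, c p ∂P = w2Sq μ ν := by
    rw [← h.2, planCost]
    have hf : Measurable fun z : Rd d × Rd d => ‖z.1 - z.2‖ₑ ^ 2 := by fun_prop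
    have : P.map Prod.fst = (π : Measure (Rd d × Rd d)) := by simp [hP]
    conv_rhs => rw [← this, lintegral_map hf measurable_fst]
  have hle : w2Sq μ ν ≤ ∫⁻ p, ‖p.1.1 - Y p‖ₑ ^ 2 ∂P :=
    w2Sq_le_lintegral P (by fun_prop) hY hXlaw hYlaw
  have h1 : ∫⁻ p in B, ‖p.1.1 - Y p‖ₑ ^ 2 ∂P = ∫⁻ p in B, c' p ∂P :=
    setLIntegral_congr_fun hB fun p hp => by simp only [Y, c', if_pos hp]
  have h2 : ∫⁻ p in Bᶜ, ‖p.1.1 - Y p‖ₑ ^ 2 ∂P = ∫⁻ p in Bᶜ, c p ∂P :=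
    setLIntegral_congr_fun hB.compl fun p hp => by
      simp only [Y, c, if_neg (show p ∉ B from hp)]
  have hfinc : ∫⁻ p in B, c p ∂P ≠ ∞ :=
    ne_top_of_le_ne_top (hcP ▸ hfin) (setLIntegral_le_lintegral _ _)
  have hfinc2 : ∫⁻ p in Bᶜ, c p ∂P ≠ ∞ :=
    ne_top_of_le_ne_top (hcP ▸ hfin) (setLIntegral_le_lintegral _ _)
  -- Optimality compares the total costs; the finite common part outside `B` cancels.
  have hcc' : ∫⁻ p in B, c p ∂P ≤ ∫⁻ p in B, c' p ∂P := by
    rw [← hcP, ← lintegral_add_compl c hB,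
      ← lintegral_add_compl (fun p => ‖p.1.1 - Y p‖ₑ ^ 2) hB, h1, h2] at hle
    exact (ENNReal.add_le_add_iff_right hfinc2).1 hle
  by_contra hne
  -- Adding the swapped integrand doubles each integral and makes `cross_cost_lt` applicable
  -- pointwise. The strict integral inequality needs the smaller side finite; if it is infinite, the
  -- weak one already contradicts `hfinc`.
  by_cases hfinc' : ∫⁻ p in B, c' p ∂P = ∞
  · have : ∫⁻ p in B, (c' p + c' p.swap) ∂P ≤ ∫⁻ p in B, (c p + c p.swap) ∂P :=
      setLIntegral_mono (by fun_prop) fun p hp => (cross_cost_lt hp).le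
    rw [lintegral_add_left hc', lintegral_add_left hc, hlint c hc, hlint c' hc', hfinc'] at this
    simp only [top_add, top_le_iff, ENNReal.add_eq_top, or_self] at this
    exact hfinc this
  · have : ∫⁻ p in B, (c' p + c' p.swap) ∂P < ∫⁻ p in B, (c p + c p.swap) ∂P := by
      refine setLIntegral_strict_mono hB hne (by fun_prop) ?_
        (Filter.Eventually.of_forall fun p hp => cross_cost_lt hp)
      rw [lintegral_add_left hc', hlint c' hc']
      exact ENNReal.add_ne_top.2 ⟨hfinc', hfinc'⟩
    rw [lintegral_add_left hc', lintegral_add_left hc, hlint c hc, hlint c' hc'] at this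
    exact absurd (add_le_add hcc' hcc') (not_le.2 this)

/-- The support of an optimal coupling of finite cost is a monotone set. -/
theorem IsOptimalCoupling.inner_nonneg_of_mem_support {μ ν : ProbabilityMeasure (Rd d)}
    {π : ProbabilityMeasure (Rd d × Rd d)} (h : IsOptimalCoupling μ ν π) (hfin : w2Sq μ ν ≠ ∞)
    {z z' : Rd d × Rd d} (hz : z ∈ (π : Measure (Rd d × Rd d)).support)
    (hz' : z' ∈ (π : Measure (Rd d × Rd d)).support) :
    0 ≤ inner ℝ (z.1 - z'.1) (z.2 - z'.2) := by
  by_contra! hneg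
  have hB : IsOpen {p : (Rd d × Rd d) × (Rd d × Rd d) |
      inner ℝ (p.1.1 - p.2.1) (p.1.2 - p.2.2) < 0} := isOpen_lt (by fun_prop) continuous_const
  -- A product neighbourhood of two support points has positive `π ⊗ π` measure.
  obtain ⟨U, hU, V, hV, hUV⟩ := mem_nhds_prod_iff.1
    (hB.mem_nhds (show (z, z') ∈ _ from hneg))
  have h0 := measure_mono_null hUV (h.measure_prod_inner_neg hfin)
  rw [Measure.prod_prod] at h0
  rw [Measure.mem_support_iff_forall] at hz hz'
  exact (mul_ne_zero (hz U hU).ne' (hz' V hV).ne') h0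

/-! ### Monotone relations are graphs; Brenier's theorem. -/

/-- A closed set here is σ-compact, and so is its continuous image. -/
theorem measurableSet_image_fst_of_isClosed {Γ : Set (Rd d × Rd d)} (hΓ : IsClosed Γ) :
    MeasurableSet (Prod.fst '' Γ) := by
  obtain ⟨K, hK, hKΓ⟩ := (isSigmaCompact_univ.of_isClosed_subset hΓ (Set.subset_univ _)).image continuous_fst
  rw [← hKΓ]
  exact MeasurableSet.iUnion fun n => (hK n).measurableSet

/-- A closed monotone relation is almost everywhere single valued. -/
theorem ae_subsingleton_of_monotone {Γ : Set (Rd d × Rd d)} (hΓ : IsClosed Γ)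
    (hmono : ∀ z ∈ Γ, ∀ z' ∈ Γ, 0 ≤ inner ℝ (z.1 - z'.1) (z.2 - z'.2)) :
    ∀ᵐ x ∂(volume : Measure (Rd d)), {y | (x, y) ∈ Γ}.Subsingleton := by
  -- Two distinct points in one fibre differ in some coordinate `i`, where rationals `q < r`
  -- separate them; the base point then lies in `F i q ∩ G i r`.
  let F (i : Fin d) (q : ℚ) : Set (Rd d) := Prod.fst '' (Γ ∩ {z | z.2 i ≤ q})
  let G (i : Fin d) (r : ℚ) : Set (Rd d) := Prod.fst '' (Γ ∩ {z | (r : ℝ) ≤ z.2 i})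
  have hF (i q) : MeasurableSet (F i q) := measurableSet_image_fst_of_isClosed
    (hΓ.inter (isClosed_le (by fun_prop) continuous_const))
  have hG (i r) : MeasurableSet (G i r) := measurableSet_image_fst_of_isClosed
    (hΓ.inter (isClosed_le continuous_const (by fun_prop)))
  have key (i : Fin d) (q r : ℚ) (hqr : q < r) :
      ∀ᵐ x ∂(volume : Measure (Rd d)), x ∈ (F i q ∩ G i r)ᶜ := by
    -- Slice along lines in direction `i`: by monotonicity each line meets the exceptional set at
    -- most once.
    refine ae_mem_of_ae_add_linearMap_mem
      (LinearMap.toSpanSingleton ℝ (Rd d) (EuclideanSpace.single i 1)) volume volume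
      ((hF i q).inter (hG i r)).compl fun x => ?_
    have hlt (s t : ℝ) (hs : x + s • EuclideanSpace.single i (1 : ℝ) ∈ G i r)
        (ht : x + t • EuclideanSpace.single i (1 : ℝ) ∈ F i q) : t ≤ s := by
      obtain ⟨⟨x1, y1⟩, ⟨h1, hy1⟩, hx1⟩ := hs
      obtain ⟨⟨x2, y2⟩, ⟨h2, hy2⟩, hx2⟩ := ht
      simp only at hx1 hx2
      subst hx1 hx2
      have := hmono _ h2 _ h1
      simp only [add_sub_add_left_eq_sub, ← sub_smul, real_inner_smul_left,
        EuclideanSpace.inner_single_left, map_one, one_mul, PiLp.sub_apply] at this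
      simp only [Set.mem_ofPred_eq] at hy1 hy2
      have hqr' : (q : ℝ) < r := by exact_mod_cast hqr
      by_contra! hst
      nlinarith [mul_pos (sub_pos.2 hst) (sub_pos.2 hqr')]
    have hsub : {t : ℝ | ¬ x + LinearMap.toSpanSingleton ℝ (Rd d)
        (EuclideanSpace.single i 1) t ∈ (F i q ∩ G i r)ᶜ}.Subsingleton := by
      intro s hs t ht
      simp only [LinearMap.toSpanSingleton_apply, Set.mem_compl_iff, not_not,
        Set.mem_ofPred_eq] at hs ht
      exact le_antisymm (hlt _ _ ht.2 hs.1) (hlt _ _ hs.2 ht.1)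
    exact hsub.measure_zero volume
  have hall : ∀ᵐ x ∂(volume : Measure (Rd d)), ∀ i, ∀ q r : ℚ, q < r → x ∈ (F i q ∩ G i r)ᶜ :=
    ae_all_iff.2 fun i => ae_all_iff.2 fun q => ae_all_iff.2 fun r =>
      Filter.eventually_imp_distrib_left.2 (key i q r)
  filter_upwards [hall] with x hx
  have hle (y y' : Rd d) (hy : (x, y) ∈ Γ) (hy' : (x, y') ∈ Γ) (i : Fin d) : y' i ≤ y i := by
    by_contra! hlt
    obtain ⟨q, hq, hq'⟩ := exists_rat_btwn hlt
    obtain ⟨r, hr, hr'⟩ := exists_rat_btwn hq'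
    exact hx i q r (by exact_mod_cast hr) ⟨⟨(x, y), ⟨hy, hq.le⟩, rfl⟩, ⟨(x, y'), ⟨hy', hr'.le⟩, rfl⟩⟩
  intro y hy y' hy'
  ext i
  exact le_antisymm (hle _ _ hy' hy i) (hle _ _ hy hy' i)

/-- An optimal coupling with absolutely continuous first marginal is concentrated on a graph. -/
theorem IsOptimalCoupling.exists_graph {μ ν : ProbabilityMeasure (Rd d)}
    {π : ProbabilityMeasure (Rd d × Rd d)} (h : IsOptimalCoupling μ ν π) (hfin : w2Sq μ ν ≠ ∞)
    (hμ : (μ : Measure (Rd d)) ≪ volume) :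
    ∃ T : Rd d → Rd d, Measurable T ∧ ∀ᵐ z ∂(π : Measure (Rd d × Rd d)), z.2 = T z.1 := by
  let κ : Kernel (Rd d) (Rd d) := (π : Measure (Rd d × Rd d)).condKernel
  have hdis : (μ : Measure (Rd d)) ⊗ₘ κ = (π : Measure (Rd d × Rd d)) := by
    rw [← h.1.1]
    exact Measure.disintegrate _ _
  -- The conditional law turns out to be a Dirac mass almost everywhere; its mean picks out the atom
  -- measurably.
  have hT : Measurable fun x => ∫ y, y ∂(κ x) :=
    (StronglyMeasurable.integral_kernel (f := fun y : Rd d => y) stronglyMeasurable_id).measurable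
  refine ⟨fun x => ∫ y, y ∂(κ x), hT, ?_⟩
  have hsupp : ∀ᵐ z ∂(π : Measure (Rd d × Rd d)), z ∈ (π : Measure (Rd d × Rd d)).support :=
    Measure.support_mem_ae
  rw [← hdis] at hsupp ⊢
  rw [Measure.ae_compProd_iff (p := fun z => z.2 = ∫ y, y ∂(κ z.1))
    (measurableSet_eq_fun measurable_snd (hT.comp measurable_fst))]
  have hsub := hμ.ae_le (ae_subsingleton_of_monotone
    (Measure.isClosed_support (μ := (π : Measure (Rd d × Rd d))))
    fun z hz z' hz' => h.inner_nonneg_of_mem_support hfin hz hz')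
  filter_upwards [Measure.ae_ae_of_ae_compProd hsupp, hsub] with x hx hxs
  rw [hdis] at hx
  obtain ⟨y₀, hy₀⟩ := hx.exists
  have hae : ∀ᵐ y ∂(κ x), y = y₀ := hx.mono fun y hy => hxs hy hy₀
  have hint : ∫ y, y ∂(κ x) = y₀ := by
    rw [integral_congr_ae hae]
    simp
  simpa only [hint] using hae

theorem IsCoupling.eq_map_of_graph {μ ν : ProbabilityMeasure (Rd d)}
    {π : ProbabilityMeasure (Rd d × Rd d)} (h : IsCoupling μ ν π) {T : Rd d → Rd d}
    (hT : Measurable T) (hgraph : ∀ᵐ z ∂(π : Measure (Rd d × Rd d)), z.2 = T z.1) :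
    (π : Measure (Rd d × Rd d)) = (μ : Measure (Rd d)).map fun x => (x, T x) := by
  rw [← h.1, Measure.map_map (by fun_prop) measurable_fst]
  conv_lhs => rw [← Measure.map_id (μ := (π : Measure (Rd d × Rd d)))]
  exact Measure.map_congr (hgraph.mono fun z hz => Prod.ext rfl hz)

/-- Uniqueness of optimal couplings with absolutely continuous first marginal. -/
theorem IsOptimalCoupling.unique {μ ν : ProbabilityMeasure (Rd d)}
    {π π' : ProbabilityMeasure (Rd d × Rd d)} (h : IsOptimalCoupling μ ν π)
    (h' : IsOptimalCoupling μ ν π') (hfin : w2Sq μ ν ≠ ∞)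
    (hμ : (μ : Measure (Rd d)) ≪ volume) : π = π' := by
  -- The midpoint of two optimal plans is optimal, so a single graph carries both.
  let R : Measure (Rd d × Rd d) :=
    (2 : ℝ≥0∞)⁻¹ • (π : Measure (Rd d × Rd d)) + (2 : ℝ≥0∞)⁻¹ • (π' : Measure (Rd d × Rd d))
  have hR : IsProbabilityMeasure R := ⟨by simp [R, ENNReal.inv_two_add_inv_two]⟩
  have hρ : IsOptimalCoupling μ ν ⟨R, hR⟩ := by
    refine ⟨⟨?_, ?_⟩, ?_⟩
    · change R.map Prod.fst = _
      simp only [R, Measure.map_add _ _ measurable_fst, Measure.map_smul, h.1.1, h'.1.1]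
      rw [← add_smul, ENNReal.inv_two_add_inv_two, one_smul]
    · change R.map Prod.snd = _
      simp only [R, Measure.map_add _ _ measurable_snd, Measure.map_smul, h.1.2, h'.1.2]
      rw [← add_smul, ENNReal.inv_two_add_inv_two, one_smul]
    · change planCost R = _
      have e := h.2
      have e' := h'.2
      simp only [planCost] at e e'
      simp only [planCost, R, lintegral_add_measure, lintegral_smul_measure, e, e', smul_eq_mul]
      rw [← add_mul, ENNReal.inv_two_add_inv_two, one_mul]
  obtain ⟨T, hT, hg⟩ := hρ.exists_graph hfin hμ
  change ∀ᵐ z ∂(R), z.2 = T z.1 at hg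
  have h2 : (2 : ℝ≥0∞)⁻¹ ≠ 0 := by simp
  rw [ae_add_measure_iff, Measure.ae_ennreal_smul_measure_iff h2,
    Measure.ae_ennreal_smul_measure_iff h2] at hg
  apply ProbabilityMeasure.toMeasure_injective
  rw [h.1.eq_map_of_graph hT hg.1, h'.1.eq_map_of_graph hT hg.2]

/-! ### Optimal transport maps. -/

theorem w2Sq_le_mapCost {μ ν : ProbabilityMeasure (Rd d)} {T : Rd d → Rd d}
    (hT : IsTransportMap μ ν T) : w2Sq μ ν ≤ mapCost μ T := by
  refine (w2Sq_le_lintegral (μ : Measure (Rd d)) measurable_id hT.1 (by simp) hT.2).trans_eq ?_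
  exact lintegral_congr fun x => by rw [← enorm_neg, neg_sub]; rfl

/-- Brenier's theorem: an optimal map exists and its cost is the squared Wasserstein distance. -/
theorem exists_transportMap_mapCost_eq {μ ν : ProbabilityMeasure (Rd d)} (hμ : IsP2ac μ)
    (hν : HasSecondMoment ν) : ∃ T, IsTransportMap μ ν T ∧ mapCost μ T = w2Sq μ ν := by
  obtain ⟨π, hπ⟩ := exists_isOptimalCoupling μ ν
  obtain ⟨T, hT, hg⟩ := hπ.exists_graph (w2Sq_ne_top hμ.1 hν) hμ.2
  have hmap := hπ.1.eq_map_of_graph hT hg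
  refine ⟨T, ⟨hT, ?_⟩, ?_⟩
  · rw [← hπ.1.2, hmap, Measure.map_map measurable_snd (by fun_prop)]
    rfl
  · rw [← hπ.2, planCost, hmap, lintegral_map (by fun_prop) (by fun_prop)]
    exact lintegral_congr fun x => by rw [← enorm_neg, neg_sub]

theorem isOptimalMap_otMap {μ ν : ProbabilityMeasure (Rd d)} (hμ : IsP2ac μ)
    (hν : HasSecondMoment ν) : IsOptimalMap μ ν (otMap μ ν) := by
  obtain ⟨T, hT, hcost⟩ := exists_transportMap_mapCost_eq hμ hν
  have hex : ∃ T, IsOptimalMap μ ν T := ⟨T, hT, fun S hS => hcost.le.trans (w2Sq_le_mapCost hS)⟩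
  rw [otMap, dif_pos hex]
  exact hex.choose_spec

theorem measurable_otMap {μ ν : ProbabilityMeasure (Rd d)} (hμ : IsP2ac μ)
    (hν : HasSecondMoment ν) : Measurable (otMap μ ν) :=
  (isOptimalMap_otMap hμ hν).1.1

theorem map_otMap {μ ν : ProbabilityMeasure (Rd d)} (hμ : IsP2ac μ)
    (hν : HasSecondMoment ν) : (μ : Measure (Rd d)).map (otMap μ ν) = ν :=
  (isOptimalMap_otMap hμ hν).1.2

theorem mapCost_otMap {μ ν : ProbabilityMeasure (Rd d)} (hμ : IsP2ac μ)
    (hν : HasSecondMoment ν) : mapCost μ (otMap μ ν) = w2Sq μ ν := by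
  obtain ⟨T, hT, hcost⟩ := exists_transportMap_mapCost_eq hμ hν
  exact le_antisymm (((isOptimalMap_otMap hμ hν).2 T hT).trans hcost.le)
    (w2Sq_le_mapCost (isOptimalMap_otMap hμ hν).1)

/-- Optimally coupled random variables are related by the optimal transport map. -/
theorem ae_eq_otMap_of_lintegral_le {Ω : Type*} [MeasurableSpace Ω] (P : Measure Ω)
    [IsProbabilityMeasure P] {μ ν : ProbabilityMeasure (Rd d)} (hμ : IsP2ac μ)
    (hν : HasSecondMoment ν) {X Y : Ω → Rd d} (hX : Measurable X) (hY : Measurable Y)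
    (hXμ : P.map X = μ) (hYν : P.map Y = ν)
    (hle : ∫⁻ ω, ‖X ω - Y ω‖ₑ ^ 2 ∂P ≤ w2Sq μ ν) : ∀ᵐ ω ∂P, Y ω = otMap μ ν (X ω) := by
  have hT := measurable_otMap hμ hν
  have hXY : Measurable fun ω => (X ω, Y ω) := hX.prodMk hY
  have hG : Measurable fun x => (x, otMap μ ν x) := measurable_id.prodMk hT
  let π : ProbabilityMeasure (Rd d × Rd d) :=
    ⟨P.map fun ω => (X ω, Y ω), Measure.isProbabilityMeasure_map hXY.aemeasurable⟩
  let π' : ProbabilityMeasure (Rd d × Rd d) :=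
    ⟨(μ : Measure (Rd d)).map fun x => (x, otMap μ ν x),
      Measure.isProbabilityMeasure_map hG.aemeasurable⟩
  have hπ : IsCoupling μ ν π := by
    constructor
    · change (P.map _).map _ = _
      rw [Measure.map_map measurable_fst hXY, ← hXμ]; rfl
    · change (P.map _).map _ = _
      rw [Measure.map_map measurable_snd hXY, ← hYν]; rfl
  have hπ' : IsCoupling μ ν π' := by
    constructor
    · change ((μ : Measure (Rd d)).map _).map _ = _
      rw [Measure.map_map measurable_fst hG]
      exact Measure.map_id
    · change ((μ : Measure (Rd d)).map _).map _ = _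
      rw [Measure.map_map measurable_snd hG]
      exact map_otMap hμ hν
  have hc : IsOptimalCoupling μ ν π := by
    refine ⟨hπ, le_antisymm ?_ (w2Sq_le_planCost hπ)⟩
    change ∫⁻ z, _ ∂(P.map _) ≤ _
    rwa [lintegral_map (by fun_prop) hXY]
  have hc' : IsOptimalCoupling μ ν π' := by
    refine ⟨hπ', ?_⟩
    change ∫⁻ z, _ ∂((μ : Measure (Rd d)).map _) = _
    rw [lintegral_map (by fun_prop) hG, ← mapCost_otMap hμ hν]
    exact lintegral_congr fun x => by rw [← enorm_neg, neg_sub]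
  have heq : P.map (fun ω => (X ω, Y ω)) = (μ : Measure (Rd d)).map fun x => (x, otMap μ ν x) :=
    congrArg Subtype.val (hc.unique hc' (w2Sq_ne_top hμ.1 hν) hμ.2)
  have hmeas : MeasurableSet {z : Rd d × Rd d | z.2 = otMap μ ν z.1} :=
    measurableSet_eq_fun measurable_snd (hT.comp measurable_fst)
  have : ∀ᵐ z ∂(P.map fun ω => (X ω, Y ω)), z.2 = otMap μ ν z.1 := by
    rw [heq, ae_map_iff hG.aemeasurable hmeas]
    simp
  rwa [ae_map_iff hXY.aemeasurable hmeas] at this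

/-! ### Variance decomposition. -/

/-- The parallel axis identity. The double sum runs over ordered pairs, whence the factor `1/2`. -/
theorem sum_mul_norm_sub_sq {E ι : Type*} [NormedAddCommGroup E] [InnerProductSpace ℝ E]
    [Fintype ι] {w : ι → ℝ} (hw : ∑ i, w i = 1) (y : E) (x : ι → E) :
    ∑ i, w i * ‖y - x i‖ ^ 2
      = ‖y - ∑ i, w i • x i‖ ^ 2 + ∑ i, ∑ j, w i * w j / 2 * ‖x i - x j‖ ^ 2 := by
  have h1 : ∑ i, w i * ‖y - x i‖ ^ 2
      = ‖y‖ ^ 2 - 2 * ∑ i, w i * inner ℝ y (x i) + ∑ i, w i * ‖x i‖ ^ 2 := by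
    calc ∑ i, w i * ‖y - x i‖ ^ 2
        = ∑ i, (w i * ‖y‖ ^ 2 - 2 * (w i * inner ℝ y (x i)) + w i * ‖x i‖ ^ 2) :=
          Finset.sum_congr rfl fun i _ => by rw [norm_sub_sq_real]; ring
      _ = _ := by
          rw [Finset.sum_add_distrib, Finset.sum_sub_distrib, ← Finset.sum_mul, hw, one_mul,
            Finset.mul_sum]
  have h2 : ‖∑ i, w i • x i‖ ^ 2 = ∑ i, ∑ j, w i * w j * inner ℝ (x i) (x j) := by
    rw [← real_inner_self_eq_norm_sq, sum_inner]
    refine Finset.sum_congr rfl fun i _ => ?_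
    rw [inner_sum]
    refine Finset.sum_congr rfl fun j _ => ?_
    rw [real_inner_smul_left, real_inner_smul_right]
    ring
  have h3 : ∑ i, ∑ j, w i * w j / 2 * ‖x i - x j‖ ^ 2
      = ∑ i, w i * ‖x i‖ ^ 2 - ∑ i, ∑ j, w i * w j * inner ℝ (x i) (x j) := by
    calc ∑ i, ∑ j, w i * w j / 2 * ‖x i - x j‖ ^ 2
        = ∑ i, ∑ j, (w i * ‖x i‖ ^ 2 / 2 * w j + w i / 2 * (w j * ‖x j‖ ^ 2)
            - w i * w j * inner ℝ (x i) (x j)) :=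
          Finset.sum_congr rfl fun i _ => Finset.sum_congr rfl fun j _ => by
            rw [norm_sub_sq_real]; ring
      _ = _ := by
          simp only [Finset.sum_add_distrib, Finset.sum_sub_distrib, ← Finset.mul_sum,
            ← Finset.sum_mul, ← Finset.sum_div, hw]
          ring
  rw [h1, h3, norm_sub_sq_real, h2, inner_sum]
  simp only [real_inner_smul_right]
  ring

theorem sum_ofReal_mul_enorm_sub_sq {E ι : Type*} [NormedAddCommGroup E] [InnerProductSpace ℝ E]
    [Fintype ι] {w : ι → ℝ} (hw₀ : ∀ i, 0 ≤ w i) (hw : ∑ i, w i = 1) (y : E) (x : ι → E) :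
    ∑ i, ENNReal.ofReal (w i) * ‖y - x i‖ₑ ^ 2
      = ‖y - ∑ i, w i • x i‖ₑ ^ 2
        + ∑ i, ∑ j, ENNReal.ofReal (w i * w j / 2) * ‖x i - x j‖ₑ ^ 2 := by
  have hc (i j : ι) : 0 ≤ w i * w j / 2 := by have := hw₀ i; have := hw₀ j; positivity
  have hn (i j : ι) : 0 ≤ w i * w j / 2 * ‖x i - x j‖ ^ 2 := mul_nonneg (hc i j) (sq_nonneg _)
  simp only [enorm_sq_eq_ofReal, ← ENNReal.ofReal_mul (hw₀ _), ← ENNReal.ofReal_mul (hc _ _)]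
  rw [← ENNReal.ofReal_sum_of_nonneg fun i _ => mul_nonneg (hw₀ i) (sq_nonneg _),
    sum_mul_norm_sub_sq hw, ENNReal.ofReal_add (sq_nonneg _)
      (Finset.sum_nonneg fun i _ => Finset.sum_nonneg fun j _ => hn i j),
    ENNReal.ofReal_sum_of_nonneg fun i _ => Finset.sum_nonneg fun j _ => hn i j]
  congr 1
  exact Finset.sum_congr rfl fun i _ => ENNReal.ofReal_sum_of_nonneg fun j _ => hn i j

/-- The variance decomposition of a weighted sum of squared distances. -/
theorem sum_ofReal_mul_lintegral_enorm_sub_sq {Ω ι : Type*} [MeasurableSpace Ω] [Fintype ι]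
    (P : Measure Ω) {w : ι → ℝ} (hw₀ : ∀ i, 0 ≤ w i) (hw : ∑ i, w i = 1) {Y : Ω → Rd d}
    {X : ι → Ω → Rd d} (hY : Measurable Y) (hX : ∀ i, Measurable (X i)) :
    ∑ i, ENNReal.ofReal (w i) * ∫⁻ ω, ‖Y ω - X i ω‖ₑ ^ 2 ∂P
      = ∫⁻ ω, ‖Y ω - ∑ i, w i • X i ω‖ₑ ^ 2 ∂P
        + ∑ i, ∑ j, ENNReal.ofReal (w i * w j / 2) * ∫⁻ ω, ‖X i ω - X j ω‖ₑ ^ 2 ∂P := by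
  have hm (i : ι) : Measurable fun ω => ‖Y ω - X i ω‖ₑ ^ 2 := by fun_prop
  have hm' (i j : ι) : Measurable fun ω => ‖X i ω - X j ω‖ₑ ^ 2 := by fun_prop
  have hm'' : Measurable fun ω => ‖Y ω - ∑ i, w i • X i ω‖ₑ ^ 2 := by fun_prop
  simp only [← lintegral_const_mul _ (hm _), ← lintegral_const_mul _ (hm' _ _)]
  rw [← lintegral_finsetSum _ fun i _ => (hm i).const_mul _]
  simp only [sum_ofReal_mul_enorm_sub_sq hw₀ hw]
  rw [lintegral_add_left hm'', lintegral_finsetSum _ fun i _ =>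
    Finset.measurable_fun_sum _ fun j _ => (hm' i j).const_mul _]
  congr 1
  exact Finset.sum_congr rfl fun i _ => lintegral_finsetSum _ fun j _ => (hm' i j).const_mul _

/-- Serves the equality case of the Wasserstein problem, for the outer and then the inner sum;
finiteness allows cancellation in `[0, ∞]`. -/
theorem eq_of_sum_le_sum_of_le {ι : Type*} [Fintype ι] {f g : ι → ℝ≥0∞} (hgf : ∀ i, g i ≤ f i)
    (hsum : ∑ i, f i ≤ ∑ i, g i) (hfin : ∑ i, g i ≠ ∞) (i : ι) : f i = g i := by
  classical
  refine le_antisymm ?_ (hgf i)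
  rw [← Finset.add_sum_erase _ f (Finset.mem_univ i),
    ← Finset.add_sum_erase _ g (Finset.mem_univ i)] at hsum
  rw [← Finset.add_sum_erase _ g (Finset.mem_univ i)] at hfin
  have hle := hsum.trans (add_le_add_right
    (Finset.sum_le_sum fun j _ => hgf j : ∑ j ∈ Finset.univ.erase i, g j ≤ _) (g i))
  refine (ENNReal.add_le_add_iff_right ?_).1 hle
  exact ne_top_of_le_ne_top (ne_top_of_le_ne_top hfin hsum) le_add_self

/-! ### The average map and its optimality. -/

/-- The weighted average of the optimal maps from `μ₀` to the measures `μ i`. -/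
def averageMap (μ₀ : ProbabilityMeasure (Rd d)) (μ : Fin m → ProbabilityMeasure (Rd d))
    (w : Fin m → ℝ) (x : Rd d) : Rd d :=
  ∑ i, w i • otMap μ₀ (μ i) x

/-- The optimal value of the multimarginal problem associated with the barycenter. -/
def pairCost (μ : Fin m → ProbabilityMeasure (Rd d)) (w : Fin m → ℝ) : ℝ≥0∞ :=
  ∑ i, ∑ j, ENNReal.ofReal (w i * w j / 2) * w2Sq (μ i) (μ j)

theorem pairCost_ne_top {μ : Fin m → ProbabilityMeasure (Rd d)} (hμ : ∀ i, IsP2ac (μ i))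
    (w : Fin m → ℝ) : pairCost μ w ≠ ∞ :=
  ENNReal.sum_ne_top.2 fun i _ => ENNReal.sum_ne_top.2 fun j _ =>
    ENNReal.mul_ne_top ENNReal.ofReal_ne_top (w2Sq_ne_top (hμ i).1 (hμ j).1)

theorem memLp_otMap {μ ν : ProbabilityMeasure (Rd d)} (hμ : IsP2ac μ) (hν : HasSecondMoment ν) :
    MemLp (otMap μ ν) 2 (μ : Measure (Rd d)) := by
  have h := hν
  rw [HasSecondMoment, ← map_otMap hμ hν] at h
  exact (memLp_map_measure_iff aestronglyMeasurable_id (measurable_otMap hμ hν).aemeasurable).1 h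

theorem measurable_averageMap {μ₀ : ProbabilityMeasure (Rd d)}
    {μ : Fin m → ProbabilityMeasure (Rd d)} (hμ₀ : IsP2ac μ₀) (hμ : ∀ i, HasSecondMoment (μ i))
    (w : Fin m → ℝ) : Measurable (averageMap μ₀ μ w) :=
  Finset.measurable_fun_sum _ fun i _ => (measurable_otMap hμ₀ (hμ i)).const_smul (w i)

/-- If `ν = T # μ'`, every coupling of `μ` and `ν` lifts to a coupling of `μ` and `μ'`. -/
theorem IsCoupling.exists_lift {μ ν μ' : ProbabilityMeasure (Rd d)}
    {π : ProbabilityMeasure (Rd d × Rd d)} (h : IsCoupling μ ν π) {T : Rd d → Rd d}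
    (hT : IsTransportMap μ' ν T) :
    ∃ Q : Measure (Rd d × Rd d), IsProbabilityMeasure Q ∧
      Q.map Prod.fst = (μ : Measure (Rd d)) ∧ Q.map Prod.snd = (μ' : Measure (Rd d)) ∧
      ∫⁻ z, ‖z.1 - T z.2‖ₑ ^ 2 ∂Q = planCost (π : Measure (Rd d × Rd d)) := by
  have hG : Measurable fun x => (T x, x) := hT.1.prodMk measurable_id
  let π₁ : ProbabilityMeasure (Rd d × Rd d) :=
    ⟨(π : Measure (Rd d × Rd d)).map Prod.swap,
      Measure.isProbabilityMeasure_map measurable_swap.aemeasurable⟩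
  let π₂ : ProbabilityMeasure (Rd d × Rd d) :=
    ⟨(μ' : Measure (Rd d)).map fun x => (T x, x),
      Measure.isProbabilityMeasure_map hG.aemeasurable⟩
  have h₁ : (π₁ : Measure (Rd d × Rd d)) = (π : Measure (Rd d × Rd d)).map Prod.swap := rfl
  have h₂ : (π₂ : Measure (Rd d × Rd d)) = (μ' : Measure (Rd d)).map fun x => (T x, x) := rfl
  -- Both plans are reversed so that the shared marginal `ν` comes first.
  obtain ⟨Q, hQ, hQπ⟩ := exists_glue ν (fun b : Bool => cond b π₁ π₂) (by
    rintro (_ | _)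
    · simp only [cond_false, h₂]
      rw [Measure.map_map measurable_fst hG]
      exact hT.2
    · simp only [cond_true, h₁]
      rw [Measure.map_map measurable_fst measurable_swap]
      exact h.2)
  have hQ₁ := hQπ true
  have hQ₂ := hQπ false
  simp only [cond_true, cond_false, h₁, h₂] at hQ₁ hQ₂
  have hm : Measurable fun p : Rd d × (Bool → Rd d) => (p.2 true, p.2 false) := by fun_prop
  have hmt : Measurable fun p : Rd d × (Bool → Rd d) => (p.1, p.2 true) := by fun_prop
  have hmf : Measurable fun p : Rd d × (Bool → Rd d) => (p.1, p.2 false) := by fun_prop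
  have hTQ : ∀ᵐ p ∂Q, p.1 = T (p.2 false) := by
    have hmeas : MeasurableSet {z : Rd d × Rd d | z.1 = T z.2} :=
      measurableSet_eq_fun measurable_fst (hT.1.comp measurable_snd)
    have : ∀ᵐ z ∂(Q.map fun p => (p.1, p.2 false)), z.1 = T z.2 := by
      rw [hQ₂, ae_map_iff hG.aemeasurable hmeas]
      simp
    rwa [ae_map_iff hmf.aemeasurable hmeas] at this
  refine ⟨Q.map fun p => (p.2 true, p.2 false), Measure.isProbabilityMeasure_map hm.aemeasurable,
    ?_, ?_, ?_⟩
  · have := congrArg (Measure.map Prod.snd) hQ₁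
    rw [Measure.map_map measurable_snd hmt, Measure.map_map measurable_snd measurable_swap] at this
    rw [Measure.map_map measurable_fst hm, ← h.1]
    exact this
  · have := congrArg (Measure.map Prod.snd) hQ₂
    rw [Measure.map_map measurable_snd hmf, Measure.map_map measurable_snd hG] at this
    rw [Measure.map_map measurable_snd hm]
    exact this.trans Measure.map_id
  · have hf : Measurable fun z : Rd d × Rd d => ‖z.1 - T z.2‖ₑ ^ 2 := by
      have := hT.1
      fun_prop
    have hf' : Measurable fun z : Rd d × Rd d => ‖z.2 - z.1‖ₑ ^ 2 := by fun_prop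
    rw [lintegral_map hf hm]
    calc ∫⁻ p, ‖p.2 true - T (p.2 false)‖ₑ ^ 2 ∂Q
        = ∫⁻ p, ‖p.2 true - p.1‖ₑ ^ 2 ∂Q :=
          lintegral_congr_ae (hTQ.mono fun p hp => by simp only [← hp])
      _ = ∫⁻ z, ‖z.2 - z.1‖ₑ ^ 2 ∂(Q.map fun p => (p.1, p.2 true)) :=
          (lintegral_map hf' hmt).symm
      _ = planCost (π : Measure (Rd d × Rd d)) := by
          rw [hQ₁, lintegral_map hf' measurable_swap]
          rfl

/-- The averaged map is optimal between its marginals. -/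
theorem lintegral_averageMap_le_w2Sq {μ₀ ν : ProbabilityMeasure (Rd d)}
    {μ : Fin m → ProbabilityMeasure (Rd d)} (hμ₀ : IsP2ac μ₀) (hμ : ∀ i, HasSecondMoment (μ i))
    {w : Fin m → ℝ} (hw : w ∈ stdSimplex ℝ (Fin m))
    (hν : IsTransportMap μ₀ ν (averageMap μ₀ μ w)) :
    ∫⁻ x, ‖x - averageMap μ₀ μ w x‖ₑ ^ 2 ∂(μ₀ : Measure (Rd d)) ≤ w2Sq μ₀ ν := by
  refine le_iInf₂ fun π hπ => ?_
  obtain ⟨Q, hQ, hQ₁, hQ₂, hcost⟩ := hπ.exists_lift hν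
  change _ ≤ planCost (π : Measure (Rd d × Rd d))
  rw [← hcost]
  have hT (i : Fin m) : Measurable (otMap μ₀ (μ i)) := measurable_otMap hμ₀ (hμ i)
  -- Decompose the weighted cost of the maps, once on the diagonal of `μ₀` and once under `Q`. The
  -- pair terms depend only on the marginal `μ₀` and agree; optimality of each map orders the left
  -- sides, so cancelling orders the squared distances to the mean.
  have e₀ := sum_ofReal_mul_lintegral_enorm_sub_sq (μ₀ : Measure (Rd d)) hw.1 hw.2
    measurable_id hT
  have e₁ := sum_ofReal_mul_lintegral_enorm_sub_sq Q hw.1 hw.2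
    measurable_fst fun i => (hT i).comp measurable_snd
  have hpair (i j : Fin m) :
      ∫⁻ z, ‖(otMap μ₀ (μ i) ∘ Prod.snd) z - (otMap μ₀ (μ j) ∘ Prod.snd) z‖ₑ ^ 2 ∂Q
        = ∫⁻ x, ‖otMap μ₀ (μ i) x - otMap μ₀ (μ j) x‖ₑ ^ 2 ∂(μ₀ : Measure (Rd d)) := by
    have hf : Measurable fun x => ‖otMap μ₀ (μ i) x - otMap μ₀ (μ j) x‖ₑ ^ 2 := by
      have := hT i
      have := hT j
      fun_prop
    rw [← hQ₂, lintegral_map hf measurable_snd]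
    rfl
  simp only [hpair] at e₁
  have hle : ∑ i, ENNReal.ofReal (w i) *
        ∫⁻ x, ‖id x - otMap μ₀ (μ i) x‖ₑ ^ 2 ∂(μ₀ : Measure (Rd d))
      ≤ ∑ i, ENNReal.ofReal (w i) * ∫⁻ z, ‖z.1 - (otMap μ₀ (μ i) ∘ Prod.snd) z‖ₑ ^ 2 ∂Q := by
    refine Finset.sum_le_sum fun i _ => mul_le_mul_right ?_ _
    have hlaw : Q.map (otMap μ₀ (μ i) ∘ Prod.snd) = (μ i : Measure (Rd d)) := by
      rw [← Measure.map_map (hT i) measurable_snd, hQ₂, map_otMap hμ₀ (hμ i)]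
    refine le_trans ?_ (w2Sq_le_lintegral Q measurable_fst ((hT i).comp measurable_snd) hQ₁ hlaw)
    rw [← mapCost_otMap hμ₀ (hμ i)]
    exact (lintegral_congr fun x => by rw [← enorm_neg, neg_sub]; rfl).le
  rw [e₀, e₁] at hle
  refine (ENNReal.add_le_add_iff_right ?_).1 hle
  exact ENNReal.sum_ne_top.2 fun i _ => ENNReal.sum_ne_top.2 fun j _ =>
    ENNReal.mul_ne_top ENNReal.ofReal_ne_top
      (lintegral_enorm_sq_ne_top ((memLp_otMap hμ₀ (hμ i)).sub (memLp_otMap hμ₀ (hμ j))))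

theorem hasSecondMoment_of_averageMap {μ₀ ν : ProbabilityMeasure (Rd d)}
    {μ : Fin m → ProbabilityMeasure (Rd d)} (hμ₀ : IsP2ac μ₀) (hμ : ∀ i, HasSecondMoment (μ i))
    {w : Fin m → ℝ} (hν : IsTransportMap μ₀ ν (averageMap μ₀ μ w)) : HasSecondMoment ν := by
  rw [HasSecondMoment, ← hν.2]
  refine (memLp_map_measure_iff aestronglyMeasurable_id hν.1.aemeasurable).2 ?_
  exact memLp_finsetSum Finset.univ fun i _ => (memLp_otMap hμ₀ (hμ i)).const_smul (w i)

/-- Convex combinations of optimal maps with a common source stay optimal, without compatibility. -/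
theorem averageMap_ae_eq_otMap {μ₀ ν : ProbabilityMeasure (Rd d)}
    {μ : Fin m → ProbabilityMeasure (Rd d)} (hμ₀ : IsP2ac μ₀) (hμ : ∀ i, HasSecondMoment (μ i))
    {w : Fin m → ℝ} (hw : w ∈ stdSimplex ℝ (Fin m))
    (hν : IsTransportMap μ₀ ν (averageMap μ₀ μ w)) :
    averageMap μ₀ μ w =ᵐ[(μ₀ : Measure (Rd d))] otMap μ₀ ν :=
  ae_eq_otMap_of_lintegral_le (μ₀ : Measure (Rd d)) hμ₀ (hasSecondMoment_of_averageMap hμ₀ hμ hν)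
    measurable_id hν.1 Measure.map_id hν.2 (lintegral_averageMap_le_w2Sq hμ₀ hμ hw hν)

/-! ### The two barycenter problems. -/

/-- Compatibility turns Wasserstein distances into `L²(μ₀)` distances. -/
theorem w2Sq_eq_lintegral_otMap {μ₀ μ ν : ProbabilityMeasure (Rd d)} (hμ₀ : IsP2ac μ₀)
    (hμ : IsP2ac μ) (hν : HasSecondMoment ν)
    (hc : otMap μ₀ ν =ᵐ[(μ₀ : Measure (Rd d))] otMap μ ν ∘ otMap μ₀ μ) :
    ∫⁻ x, ‖otMap μ₀ μ x - otMap μ₀ ν x‖ₑ ^ 2 ∂(μ₀ : Measure (Rd d)) = w2Sq μ ν := by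
  have hT := measurable_otMap hμ hν
  have hf : Measurable fun x => ‖otMap μ ν x - x‖ₑ ^ 2 := by fun_prop
  rw [← mapCost_otMap hμ hν, mapCost, ← map_otMap hμ₀ hμ.1,
    lintegral_map hf (measurable_otMap hμ₀ hμ.1)]
  refine lintegral_congr_ae (hc.mono fun x hx => ?_)
  simp only [hx, Function.comp_apply]
  rw [← enorm_neg, neg_sub]

section Barycenters

variable {μ₀ : ProbabilityMeasure (Rd d)} {μ : Fin m → ProbabilityMeasure (Rd d)}
  {w : Fin m → ℝ} {ν : ProbabilityMeasure (Rd d)}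

theorem exists_weight_pos (hw : w ∈ stdSimplex ℝ (Fin m)) : ∃ i, 0 < w i := by
  by_contra! h
  have := hw.2
  have h0 := Finset.sum_nonpos fun i (_ : i ∈ Finset.univ) => h i
  linarith

/-- Some weight is positive, which matters because `0 * ∞ = 0`. -/
theorem sum_lotSq_eq_top (hw : w ∈ stdSimplex ℝ (Fin m)) (hν : ¬ HasSecondMoment ν) :
    ∑ i, ENNReal.ofReal (w i) * lotSq μ₀ ν (μ i) = ∞ := by
  obtain ⟨i, hi⟩ := exists_weight_pos hw
  refine ENNReal.sum_eq_top.2 ⟨i, Finset.mem_univ i, ?_⟩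
  rw [lotSq, if_neg fun h => hν h.1, ENNReal.mul_top (by simpa using hi)]

/-- The value of the linear barycenter functional at a measure with finite second moment. -/
theorem sum_lotSq_eq (hμ₀ : IsP2ac μ₀) (hμ : ∀ i, IsP2ac (μ i))
    (hc : ∀ i j, otMap μ₀ (μ j) =ᵐ[(μ₀ : Measure (Rd d))] otMap (μ i) (μ j) ∘ otMap μ₀ (μ i))
    (hw : w ∈ stdSimplex ℝ (Fin m)) (hν : HasSecondMoment ν) :
    ∑ i, ENNReal.ofReal (w i) * lotSq μ₀ ν (μ i)
      = ∫⁻ x, ‖otMap μ₀ ν x - averageMap μ₀ μ w x‖ₑ ^ 2 ∂(μ₀ : Measure (Rd d))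
        + pairCost μ w := by
  simp only [lotSq, hν, (hμ _).1, and_self, if_true]
  rw [sum_ofReal_mul_lintegral_enorm_sub_sq _ hw.1 hw.2 (measurable_otMap hμ₀ hν)
    fun i => measurable_otMap hμ₀ (hμ i).1]
  simp only [w2Sq_eq_lintegral_otMap hμ₀ (hμ _) (hμ _).1 (hc _ _)]
  rfl

/-- A minimiser must have optimal map equal to the average map almost everywhere, and a measure is
recovered from its map as the image of `μ₀`. -/
theorem lotBarycenters_eq_singleton (hμ₀ : IsP2ac μ₀) (hμ : ∀ i, IsP2ac (μ i))
    (hc : ∀ i j, otMap μ₀ (μ j) =ᵐ[(μ₀ : Measure (Rd d))] otMap (μ i) (μ j) ∘ otMap μ₀ (μ i))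
    (hw : w ∈ stdSimplex ℝ (Fin m)) (hν : IsTransportMap μ₀ ν (averageMap μ₀ μ w)) :
    lotBarycenters μ₀ μ w = {ν} := by
  have hμ' (i : Fin m) : HasSecondMoment (μ i) := (hμ i).1
  have hν₂ := hasSecondMoment_of_averageMap hμ₀ hμ' hν
  have hval : ∑ i, ENNReal.ofReal (w i) * lotSq μ₀ ν (μ i) = pairCost μ w := by
    have hzero : ∀ᵐ x ∂(μ₀ : Measure (Rd d)),
        ‖otMap μ₀ ν x - averageMap μ₀ μ w x‖ₑ ^ 2 = 0 := by
      filter_upwards [averageMap_ae_eq_otMap hμ₀ hμ' hw hν] with x hx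
      simp [hx]
    rw [sum_lotSq_eq hμ₀ hμ hc hw hν₂, lintegral_congr_ae hzero, lintegral_zero, zero_add]
  ext η
  simp only [lotBarycenters, Set.mem_ofPred_eq, isMinOn_univ_iff, Set.mem_singleton_iff]
  constructor
  · intro hη
    have hle := (hη ν).trans_eq hval
    have hη₂ : HasSecondMoment η := by
      by_contra hcon
      rw [sum_lotSq_eq_top hw hcon, top_le_iff] at hle
      exact pairCost_ne_top hμ w hle
    rw [sum_lotSq_eq hμ₀ hμ hc hw hη₂] at hle
    have hm := measurable_otMap hμ₀ hη₂
    have hzero : ∫⁻ x, ‖otMap μ₀ η x - averageMap μ₀ μ w x‖ₑ ^ 2 ∂(μ₀ : Measure (Rd d)) = 0 := by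
      have := (ENNReal.add_le_add_iff_right (pairCost_ne_top hμ w)).1
        (hle.trans_eq (zero_add _).symm)
      simpa using this
    rw [lintegral_eq_zero_iff' (by have := hν.1; fun_prop)] at hzero
    apply ProbabilityMeasure.toMeasure_injective
    rw [← map_otMap hμ₀ hη₂, ← hν.2]
    refine Measure.map_congr (hzero.mono fun x hx => ?_)
    simpa [sub_eq_zero] using hx
  · rintro rfl η
    rw [hval]
    by_cases hη : HasSecondMoment η
    · rw [sum_lotSq_eq hμ₀ hμ hc hw hη]
      exact le_add_self
    · rw [sum_lotSq_eq_top hw hη]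
      exact le_top

/-- The average map and the maps to the `μ i`, all defined on `μ₀`, give admissible couplings; the
distance to the mean vanishes. -/
theorem sum_w2Sq_le_pairCost (hμ₀ : IsP2ac μ₀) (hμ : ∀ i, IsP2ac (μ i))
    (hc : ∀ i j, otMap μ₀ (μ j) =ᵐ[(μ₀ : Measure (Rd d))] otMap (μ i) (μ j) ∘ otMap μ₀ (μ i))
    (hw : w ∈ stdSimplex ℝ (Fin m)) (hν : IsTransportMap μ₀ ν (averageMap μ₀ μ w)) :
    ∑ i, ENNReal.ofReal (w i) * w2Sq ν (μ i) ≤ pairCost μ w := by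
  calc ∑ i, ENNReal.ofReal (w i) * w2Sq ν (μ i)
      ≤ ∑ i, ENNReal.ofReal (w i) *
          ∫⁻ x, ‖averageMap μ₀ μ w x - otMap μ₀ (μ i) x‖ₑ ^ 2 ∂(μ₀ : Measure (Rd d)) :=
        Finset.sum_le_sum fun i _ => mul_le_mul_right (w2Sq_le_lintegral _ hν.1
          (measurable_otMap hμ₀ (hμ i).1) hν.2 (map_otMap hμ₀ (hμ i).1)) _
    _ = pairCost μ w := by
        rw [sum_ofReal_mul_lintegral_enorm_sub_sq _ hw.1 hw.2 hν.1
          fun i => measurable_otMap hμ₀ (hμ i).1]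
        simp only [w2Sq_eq_lintegral_otMap hμ₀ (hμ _) (hμ _).1 (hc _ _)]
        simp [averageMap, pairCost]

/-- Optimal couplings of `η` with all the measures `μ i`, realised on one probability space. -/
theorem exists_joint_coupling (η : ProbabilityMeasure (Rd d))
    (μ : Fin m → ProbabilityMeasure (Rd d)) (hm : 0 < m) :
    ∃ Q : Measure (Rd d × (Fin m → Rd d)), IsProbabilityMeasure Q ∧
      Q.map Prod.fst = (η : Measure (Rd d)) ∧
      (∀ i, Q.map (fun p => p.2 i) = (μ i : Measure (Rd d))) ∧
      ∀ i, ∫⁻ p, ‖p.1 - p.2 i‖ₑ ^ 2 ∂Q = w2Sq η (μ i) := by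
  choose π hπ using fun i => exists_isOptimalCoupling η (μ i)
  obtain ⟨Q, hQ, hQπ⟩ := exists_glue η π fun i => (hπ i).1.1
  have hm' (i : Fin m) : Measurable fun p : Rd d × (Fin m → Rd d) => (p.1, p.2 i) := by fun_prop
  refine ⟨Q, hQ, ?_, fun i => ?_, fun i => ?_⟩
  · rw [← (hπ ⟨0, hm⟩).1.1, ← hQπ ⟨0, hm⟩, Measure.map_map measurable_fst (hm' _)]
    rfl
  · rw [← (hπ i).1.2, ← hQπ i, Measure.map_map measurable_snd (hm' i)]
    rfl
  · rw [← (hπ i).2, planCost, ← hQπ i, lintegral_map (by fun_prop) (hm' i)]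

/-- In the glued space, drop the distance to the mean and bound each pair term below by `w2Sq`. -/
theorem pairCost_le_sum_w2Sq (hw : w ∈ stdSimplex ℝ (Fin m)) (η : ProbabilityMeasure (Rd d)) :
    pairCost μ w ≤ ∑ i, ENNReal.ofReal (w i) * w2Sq η (μ i) := by
  obtain ⟨i₀, -⟩ := exists_weight_pos hw
  obtain ⟨Q, hQ, -, hQμ, hcost⟩ := exists_joint_coupling η μ i₀.pos
  simp only [← hcost]
  have hX (i : Fin m) : Measurable fun p : Rd d × (Fin m → Rd d) => p.2 i := by fun_prop
  rw [sum_ofReal_mul_lintegral_enorm_sub_sq Q hw.1 hw.2 measurable_fst hX]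
  exact (Finset.sum_le_sum fun i _ => Finset.sum_le_sum fun j _ => mul_le_mul_right
    (w2Sq_le_lintegral Q (hX i) (hX j) (hQμ i) (hQμ j)) _).trans le_add_self

theorem eq_of_sum_w2Sq_le_pairCost (hμ₀ : IsP2ac μ₀) (hμ : ∀ i, IsP2ac (μ i))
    (hc : ∀ i j, otMap μ₀ (μ j) =ᵐ[(μ₀ : Measure (Rd d))] otMap (μ i) (μ j) ∘ otMap μ₀ (μ i))
    (hw : w ∈ stdSimplex ℝ (Fin m)) (hν : IsTransportMap μ₀ ν (averageMap μ₀ μ w))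
    {η : ProbabilityMeasure (Rd d)}
    (hη : ∑ i, ENNReal.ofReal (w i) * w2Sq η (μ i) ≤ pairCost μ w) : η = ν := by
  obtain ⟨i₀, hi₀⟩ := exists_weight_pos hw
  obtain ⟨Q, hQ, hQη, hQμ, hcost⟩ := exists_joint_coupling η μ i₀.pos
  simp only [← hcost] at hη
  have hX (i : Fin m) : Measurable fun p : Rd d × (Fin m → Rd d) => p.2 i := by fun_prop
  rw [sum_ofReal_mul_lintegral_enorm_sub_sq Q hw.1 hw.2 measurable_fst hX] at hη
  have hle (i j : Fin m) : ENNReal.ofReal (w i * w j / 2) * w2Sq (μ i) (μ j)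
      ≤ ENNReal.ofReal (w i * w j / 2) * ∫⁻ p, ‖p.2 i - p.2 j‖ₑ ^ 2 ∂Q :=
    mul_le_mul_right (w2Sq_le_lintegral Q (hX i) (hX j) (hQμ i) (hQμ j)) _
  have hpair : pairCost μ w
      ≤ ∑ i, ∑ j, ENNReal.ofReal (w i * w j / 2) * ∫⁻ p, ‖p.2 i - p.2 j‖ₑ ^ 2 ∂Q :=
    Finset.sum_le_sum fun i _ => Finset.sum_le_sum fun j _ => hle i j
  have hfin := pairCost_ne_top hμ w
  have hzero : ∫⁻ p, ‖p.1 - ∑ i, w i • p.2 i‖ₑ ^ 2 ∂Q = 0 := by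
    have := (ENNReal.add_le_add_iff_right hfin).1
      (((add_le_add_right hpair _).trans hη).trans_eq (zero_add _).symm)
    simpa using this
  have hY : ∀ᵐ p ∂Q, p.1 = ∑ i, w i • p.2 i := by
    rw [lintegral_eq_zero_iff' (by fun_prop)] at hzero
    exact hzero.mono fun p hp => by simpa [sub_eq_zero] using hp
  have houter := eq_of_sum_le_sum_of_le (fun i => Finset.sum_le_sum fun j _ => hle i j)
    (le_add_self.trans hη) hfin i₀
  -- The factor `w j` stays: when it vanishes, equality says nothing about how `X j` is coupled to
  -- `X i₀`.
  have hXj (j : Fin m) : ∀ᵐ p ∂Q, w j • p.2 j = w j • otMap (μ i₀) (μ j) (p.2 i₀) := by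
    rcases (hw.1 j).eq_or_lt with hj | hj
    · simp [← hj]
    have hinner := eq_of_sum_le_sum_of_le (hle i₀) houter.le
      (ne_top_of_le_ne_top hfin (Finset.single_le_sum
        (f := fun i => ∑ j, ENNReal.ofReal (w i * w j / 2) * w2Sq (μ i) (μ j))
        (fun _ _ => zero_le) (Finset.mem_univ i₀))) j
    have hpos : 0 < w i₀ * w j / 2 := by positivity
    have heq := (ENNReal.mul_right_inj (by simpa using hpos) ENNReal.ofReal_ne_top).1 hinner
    filter_upwards [ae_eq_otMap_of_lintegral_le Q (hμ i₀) (hμ j).1 (hX i₀) (hX j) (hQμ i₀) (hQμ j)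
      heq.le] with p hp
    rw [hp]
  have hS : Measurable (averageMap (μ i₀) μ w) := measurable_averageMap (hμ i₀) (fun i => (hμ i).1) w
  have hYS : ∀ᵐ p ∂Q, p.1 = averageMap (μ i₀) μ w (p.2 i₀) := by
    filter_upwards [hY, ae_all_iff.2 hXj] with p hp hpj
    rw [hp, averageMap]
    exact Finset.sum_congr rfl fun j _ => hpj j
  have hT₀ := measurable_otMap hμ₀ (hμ i₀).1
  apply ProbabilityMeasure.toMeasure_injective
  -- The average map based at `μ i₀`, composed with the map from `μ₀` to `μ i₀`, is by compatibility
  -- the average map based at `μ₀`.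
  calc (η : Measure (Rd d)) = Q.map Prod.fst := hQη.symm
    _ = Q.map (averageMap (μ i₀) μ w ∘ fun p => p.2 i₀) := Measure.map_congr hYS
    _ = (μ i₀ : Measure (Rd d)).map (averageMap (μ i₀) μ w) := by
        rw [← Measure.map_map hS (hX i₀), hQμ i₀]
    _ = (μ₀ : Measure (Rd d)).map (averageMap (μ i₀) μ w ∘ otMap μ₀ (μ i₀)) := by
        rw [← Measure.map_map hS hT₀, map_otMap hμ₀ (hμ i₀).1]
    _ = (μ₀ : Measure (Rd d)).map (averageMap μ₀ μ w) := by
        refine Measure.map_congr ?_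
        filter_upwards [ae_all_iff.2 fun j => hc i₀ j] with x hx
        change ∑ j, w j • otMap (μ i₀) (μ j) (otMap μ₀ (μ i₀) x) = ∑ j, w j • otMap μ₀ (μ j) x
        exact Finset.sum_congr rfl fun j _ => congrArg (w j • ·) (hx j).symm
    _ = ν := hν.2

theorem w2Barycenters_eq_singleton (hμ₀ : IsP2ac μ₀) (hμ : ∀ i, IsP2ac (μ i))
    (hc : ∀ i j, otMap μ₀ (μ j) =ᵐ[(μ₀ : Measure (Rd d))] otMap (μ i) (μ j) ∘ otMap μ₀ (μ i))
    (hw : w ∈ stdSimplex ℝ (Fin m)) (hν : IsTransportMap μ₀ ν (averageMap μ₀ μ w)) :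
    w2Barycenters μ w = {ν} := by
  have hval := sum_w2Sq_le_pairCost hμ₀ hμ hc hw hν
  ext η
  simp only [w2Barycenters, Set.mem_ofPred_eq, isMinOn_univ_iff, Set.mem_singleton_iff]
  constructor
  · exact fun hη => eq_of_sum_w2Sq_le_pairCost hμ₀ hμ hc hw hν ((hη ν).trans hval)
  · rintro rfl η
    exact hval.trans (pairCost_le_sum_w2Sq hw η)

end Barycenters

end OTBary

end

theorem mainTheorem4 (d m : ℕ) (μ : Fin (m + 1) → ProbabilityMeasure (OTBary.Rd d))
    (hμ : ∀ i, OTBary.IsP2ac (μ i)) (hcomp : OTBary.Compatible μ) :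
    OTBary.LBCM (μ 0) (fun i : Fin m => μ i.succ) = OTBary.W2BCM (fun i : Fin m => μ i.succ) ∧
    ∀ w ∈ stdSimplex ℝ (Fin m), ∃ ν : ProbabilityMeasure (OTBary.Rd d),
      OTBary.lotBarycenters (μ 0) (fun i : Fin m => μ i.succ) w = {ν} ∧
      OTBary.w2Barycenters (fun i : Fin m => μ i.succ) w = {ν} := by
  have key : ∀ w ∈ stdSimplex ℝ (Fin m), ∃ ν : ProbabilityMeasure (OTBary.Rd d),
      OTBary.lotBarycenters (μ 0) (fun i : Fin m => μ i.succ) w = {ν} ∧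
      OTBary.w2Barycenters (fun i : Fin m => μ i.succ) w = {ν} := by
    intro w hw
    have hμ' (i : Fin m) : OTBary.IsP2ac (μ i.succ) := hμ i.succ
    have hc (i j : Fin m) := hcomp 0 j.succ i.succ
    have hm := OTBary.measurable_averageMap (hμ 0) (fun i => (hμ' i).1) w
    let ν : ProbabilityMeasure (OTBary.Rd d) :=
      ⟨(μ 0 : Measure (OTBary.Rd d)).map (OTBary.averageMap (μ 0) (fun i => μ i.succ) w),
        Measure.isProbabilityMeasure_map hm.aemeasurable⟩
    have hν : OTBary.IsTransportMap (μ 0) ν (OTBary.averageMap (μ 0) (fun i => μ i.succ) w) :=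
      ⟨hm, rfl⟩
    exact ⟨ν, OTBary.lotBarycenters_eq_singleton (hμ 0) hμ' hc hw hν,
      OTBary.w2Barycenters_eq_singleton (hμ 0) hμ' hc hw hν⟩
  refine ⟨Set.iUnion₂_congr fun w hw => ?_, key⟩
  obtain ⟨ν, h₁, h₂⟩ := key w hw
  rw [h₁, h₂]
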